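/- Let $\theta>0$, $m\ge 1$ and $0=c_0<c_1<\cdots<c_m<\infty$. Let $X_1,X_2,\ldots$ be i.i.d. exponential random variables with mean $\theta$, that is, with density $\frac1\theta e^{-x/\theta}$ for $x>0$, and let $F(\cdot|\theta)$ be their cdf. For $n\ge 1$ let $\frac1n\sum_{i=1}^n \mathbf 1\{X_i\le x\}$ be the empirical cdf of $X_1,\ldots,X_n$, and let $F_n$ be the linearly interpolated empirical cdf (ogive): at the boundaries $c_0,\ldots,c_m$ it equals the empirical cdf, and $$F_n(x)=\frac{c_j-x}{c_j-c_{j-1}}F_n(c_{j-1})+\frac{x-c_{j-1}}{c_j-c_{j-1}}F_n(c_j)\qquad\text{for } c_{j-1}<x\le c_j,\ 1\le j\le m.$$ Then the vector $(F_n(c_1),\ldots,F_n(c_m))$ is asymptotically normal with mean $\mathbf F=(F(c_1|\theta),\ldots,F(c_m|\theta))$ and covariance $n^{-1}\Sigma$, where $\Sigma=[\sigma^2_{jj'}]_{j,j'=1}^m$ has the entries $\sigma^2_{jj'}=\sigma^2_{j'j}=F(c_j|\theta)\bigl(1-F(c_{j'}|\theta)\bigr)$ for $j\le j'$. That is, $\Sigma$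 is symmetric positive semidefinite and, as $n\to\infty$, $$\sqrt n\,\bigl((F_n(c_1),\ldots,F_n(c_m))-\mathbf F\bigr)\xrightarrow{d} N(0,\Sigma).$$ -/

import Mathlib

open MeasureTheory ProbabilityTheory Filter

/-- The cdf `F(x | θ)` of the exponential distribution with mean `θ`. -/
noncomputable def expCDF (θ x : ℝ) : ℝ := cdf (expMeasure (1 / θ)) x

/-- The empirical cdf of the sample `X 0, …, X (n - 1)` at the outcome `ω`: the proportion of
observations that are at most `t`. -/
noncomputable def empiricalCDF {Ω : Type*} (X : ℕ → Ω → ℝ) (n : ℕ) (ω : Ω) (t : ℝ) : ℝ :=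
  (∑ i ∈ Finset.range n, (Set.Iic t).indicator (fun _ => (1 : ℝ)) (X i ω)) / n

/-- The linearly interpolated empirical cdf (ogive) with boundaries `c 0 < c 1 < ⋯ < c m`:
for `c (j-1) < t ≤ c j` it is the linear interpolation between the values of the empirical cdf
at `c (j-1)` and `c j`. The intervals are disjoint, so at most one summand is nonzero. Outside
`(c 0, c m]`, where the ogive is not defined by interpolation, the value is the dummy `0`. -/
noncomputable def ogive {Ω : Type*} {m : ℕ} (c : Fin (m + 1) → ℝ) (X : ℕ → Ω → ℝ) (n : ℕ)
    (ω : Ω) (t : ℝ) : ℝ :=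
  ∑ j : Fin m, (Set.Ioc (c j.castSucc) (c j.succ)).indicator
    (fun x => (c j.succ - x) / (c j.succ - c j.castSucc) * empiricalCDF X n ω (c j.castSucc)
      + (x - c j.castSucc) / (c j.succ - c j.castSucc) * empiricalCDF X n ω (c j.succ)) t

/-- At a group boundary the ogive is the empirical cdf. -/
theorem ogive_boundary {Ω : Type*} {m : ℕ} {c : Fin (m + 1) → ℝ} (hc : StrictMono c)
    (X : ℕ → Ω → ℝ) (n : ℕ) (ω : Ω) (j : Fin m) :
    ogive c X n ω (c j.succ) = empiricalCDF X n ω (c j.succ) := by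
  have hlt : ∀ k : Fin m, c k.castSucc < c k.succ := fun k => hc Fin.castSucc_lt_succ
  unfold ogive
  rw [Finset.sum_eq_single j]
  · have hmem : c j.succ ∈ Set.Ioc (c j.castSucc) (c j.succ) := ⟨hlt j, le_rfl⟩
    rw [Set.indicator_of_mem hmem]
    have : c j.succ - c j.castSucc ≠ 0 := (sub_pos.2 (hlt j)).ne'
    simp [div_self this]
  · intro k _ hk
    apply Set.indicator_of_notMem
    rintro ⟨h1, h2⟩
    rw [hc.lt_iff_lt] at h1
    rw [hc.le_iff_le] at h2
    apply hk
    simp only [Fin.lt_def, Fin.le_def, Fin.val_castSucc, Fin.val_succ] at h1 h2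
    ext
    omega
  · simp

/-- The vector `(F(c 1 | θ), …, F(c m | θ))`. -/
noncomputable def boundaryCDF {m : ℕ} (θ : ℝ) (c : Fin (m + 1) → ℝ) :
    EuclideanSpace ℝ (Fin m) :=
  WithLp.toLp 2 fun j => expCDF θ (c j.succ)

/-- The random vector `(F_n(c 1), …, F_n(c m))`, where `F_n` is the ogive. -/
noncomputable def boundaryOgive {Ω : Type*} {m : ℕ} (c : Fin (m + 1) → ℝ) (X : ℕ → Ω → ℝ)
    (n : ℕ) (ω : Ω) : EuclideanSpace ℝ (Fin m) :=
  WithLp.toLp 2 fun j => ogive c X n ω (c j.succ)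

/-- The symmetric matrix with entry `F(c j | θ) (1 - F(c j' | θ))` at `(j, j')` and at `(j', j)`,
for `j ≤ j'`. -/
noncomputable def boundaryCov {m : ℕ} (θ : ℝ) (c : Fin (m + 1) → ℝ) :
    Matrix (Fin m) (Fin m) ℝ :=
  Matrix.of fun j j' => expCDF θ (c (min j j').succ) * (1 - expCDF θ (c (max j j').succ))

/-- `T n` is asymptotically normal with mean `μ` and covariance matrix `n⁻¹ S`:
`S` is a covariance matrix and `√n (T n - μ)` converges in distribution to the centered
multivariate normal distribution with covariance matrix `S`. -/
def IsAsymptoticallyNormal {Ω ι : Type*} [MeasurableSpace Ω] [Fintype ι] [DecidableEq ι]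
    (P : Measure Ω) [IsProbabilityMeasure P] (T : ℕ → Ω → EuclideanSpace ℝ ι)
    (μ : EuclideanSpace ℝ ι) (S : Matrix ι ι ℝ) : Prop :=
  S.PosSemidef ∧
    TendstoInDistribution (fun (n : ℕ) ω => √(n : ℝ) • (T n ω - μ)) atTop id
      (fun _ => P) (multivariateGaussian 0 S)

/-! At the boundaries the ogive is the empirical cdf, so the vector is a mean of i.i.d. indicator
vectors, and the Cramér–Wold device applies. Its centred and scaled inner product with `t` is a
normalized sum of i.i.d. bounded variables `weightedIndicator` of `X i`, whose variance is the
quadratic form tᵀΣt (`dotProduct_boundaryCov_mulVec`). The one-dimensional CLT, read at frequency 1,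
gives the limit exp(-tᵀΣt/2), the characteristic function of N(0, Σ) at `t`; Lévy's continuity
theorem concludes. -/

/-- Real inner product of a random vector with `t` determines the value of its characteristic
function at `t`. -/
theorem charFun_map_eq_charFun_map_inner {Ω E : Type*} [MeasurableSpace Ω] [NormedAddCommGroup E]
    [InnerProductSpace ℝ E] [MeasurableSpace E] [BorelSpace E] [SecondCountableTopology E]
    {P : Measure Ω} {Y : Ω → E} (hY : AEMeasurable Y P) (t : E) :
    charFun (P.map Y) t = charFun (P.map fun ω => inner ℝ (Y ω) t) 1 := by
  rw [charFun_apply, charFun_apply_real, integral_map hY (by fun_prop),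
    integral_map (by fun_prop) (by fun_prop)]
  simp

/-- A weighted sum of the indicators of the half-lines `(-∞, a j]`. -/
noncomputable def weightedIndicator {ι : Type*} [Fintype ι] (a t : ι → ℝ) (x : ℝ) : ℝ :=
  ∑ j, t j * (Set.Iic (a j)).indicator (fun _ => (1 : ℝ)) x

theorem measurable_indicator_Iic_one (a : ℝ) :
    Measurable ((Set.Iic a).indicator fun _ => (1 : ℝ)) :=
  measurable_const.indicator measurableSet_Iic

theorem memLp_indicator_Iic_one (ν : Measure ℝ) [IsFiniteMeasure ν] (a : ℝ) :
    MemLp ((Set.Iic a).indicator fun _ => (1 : ℝ)) 2 ν :=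
  (memLp_const 1).indicator measurableSet_Iic

theorem integral_indicator_Iic_one (ν : Measure ℝ) [IsProbabilityMeasure ν] (a : ℝ) :
    ∫ x, (Set.Iic a).indicator (fun _ => (1 : ℝ)) x ∂ν = cdf ν a := by
  rw [integral_indicator measurableSet_Iic, cdf_eq_real]
  simp

theorem mul_indicator_Iic_one (a b : ℝ) :
    ((Set.Iic a).indicator fun _ => (1 : ℝ)) * ((Set.Iic b).indicator fun _ => (1 : ℝ)) =
      (Set.Iic (min a b)).indicator fun _ => (1 : ℝ) := by
  ext x
  simp only [Pi.mul_apply, Set.indicator_apply, Set.mem_Iic, le_min_iff]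
  split_ifs <;> simp_all

/-- The product of the indicators is that of the shorter half-line, and F(a)F(b) = F(min)F(max). -/
theorem covariance_indicator_Iic (ν : Measure ℝ) [IsProbabilityMeasure ν] (a b : ℝ) :
    cov[(Set.Iic a).indicator fun _ => (1 : ℝ), (Set.Iic b).indicator fun _ => (1 : ℝ); ν] =
      cdf ν (min a b) * (1 - cdf ν (max a b)) := by
  rw [covariance_eq_sub (memLp_indicator_Iic_one ν a) (memLp_indicator_Iic_one ν b),
    mul_indicator_Iic_one]
  simp only [integral_indicator_Iic_one]
  rcases le_total a b with h | h <;> simp [h] <;> ring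

section weightedIndicator

variable {ι : Type*} [Fintype ι] (a t : ι → ℝ)

theorem measurable_weightedIndicator : Measurable (weightedIndicator a t) :=
  Finset.measurable_sum _ fun j _ => (measurable_indicator_Iic_one (a j)).const_mul (t j)

theorem memLp_weightedIndicator (ν : Measure ℝ) [IsFiniteMeasure ν] :
    MemLp (weightedIndicator a t) 2 ν :=
  memLp_finsetSum _ fun j _ => (memLp_indicator_Iic_one ν (a j)).const_mul (t j)

theorem integral_weightedIndicator (ν : Measure ℝ) [IsProbabilityMeasure ν] :
    ∫ x, weightedIndicator a t x ∂ν = ∑ j, t j * cdf ν (a j) := by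
  unfold weightedIndicator
  rw [integral_finsetSum _ fun j _ =>
    ((memLp_indicator_Iic_one ν (a j)).integrable (by norm_num)).const_mul (t j)]
  simp only [integral_const_mul, integral_indicator_Iic_one]

theorem variance_weightedIndicator (ν : Measure ℝ) [IsProbabilityMeasure ν] :
    Var[weightedIndicator a t; ν] =
      ∑ j, ∑ k, t j * (cdf ν (min (a j) (a k)) * (1 - cdf ν (max (a j) (a k)))) * t k := by
  unfold weightedIndicator
  rw [variance_fun_sum fun j => (memLp_indicator_Iic_one ν (a j)).const_mul (t j)]
  simp only [covariance_const_mul_left, covariance_const_mul_right, covariance_indicator_Iic]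
  exact Finset.sum_congr rfl fun j _ => Finset.sum_congr rfl fun k _ => by ring

end weightedIndicator

section boundary

variable {m : ℕ} {θ : ℝ} {c : Fin (m + 1) → ℝ}

/-- This identity yields both the positive semidefiniteness of Σ and the variance of the limit in
the CLT. -/
theorem dotProduct_boundaryCov_mulVec (hθ : 0 < θ) (hc : StrictMono c) (t : Fin m → ℝ) :
    dotProduct t ((boundaryCov θ c).mulVec t) =
      Var[weightedIndicator (fun j => c (Fin.succ j)) t; expMeasure (1 / θ)] := by
  have : IsProbabilityMeasure (expMeasure (1 / θ)) :=
    isProbabilityMeasure_expMeasure (one_div_pos.2 hθ)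
  have hmono : Monotone fun j : Fin m => c j.succ :=
    (hc.comp (Fin.strictMono_succ)).monotone
  rw [variance_weightedIndicator]
  simp only [dotProduct, Matrix.mulVec, boundaryCov, expCDF, Matrix.of_apply, Finset.mul_sum]
  refine Finset.sum_congr rfl fun j _ => Finset.sum_congr rfl fun k _ => ?_
  rw [← hmono.map_min, ← hmono.map_max]
  ring

theorem posSemidef_boundaryCov (hθ : 0 < θ) (hc : StrictMono c) :
    (boundaryCov θ c).PosSemidef := by
  refine Matrix.PosSemidef.of_dotProduct_mulVec_nonneg ?_ fun t => ?_
  · ext j k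
    simp [boundaryCov, min_comm, max_comm]
  · rw [star_trivial, dotProduct_boundaryCov_mulVec hθ hc]
    exact variance_nonneg _ _

theorem aemeasurable_boundaryOgive {Ω : Type*} [MeasurableSpace Ω] {P : Measure Ω}
    {X : ℕ → Ω → ℝ} (hc : StrictMono c) (hX : ∀ i, AEMeasurable (X i) P)
    (n : ℕ) : AEMeasurable (boundaryOgive c X n) P := by
  refine (WithLp.measurable_toLp 2 (Fin m → ℝ)).comp_aemeasurable
    (aemeasurable_pi_lambda _ fun j => ?_)
  simp only [ogive_boundary hc, empiricalCDF]
  exact (Finset.aemeasurable_fun_sum _ fun i _ =>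
    (measurable_indicator_Iic_one _).comp_aemeasurable (hX i)).div_const _

theorem inner_boundaryOgive_sub {Ω : Type*} (hc : StrictMono c) (X : ℕ → Ω → ℝ) (n : ℕ)
    (ω : Ω) (t : EuclideanSpace ℝ (Fin m)) :
    inner ℝ (√(n : ℝ) • (boundaryOgive c X n ω - boundaryCDF θ c)) t =
      (√(n : ℝ))⁻¹ * (∑ i ∈ Finset.range n, weightedIndicator (fun j => c j.succ) t (X i ω) -
        n * ∑ j, t j * expCDF θ (c j.succ)) := by
  -- For `n = 0` both sides vanish, as `√0 = 0` and `0⁻¹ = 0`; otherwise √n = n/√n turns means into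
  -- sums.
  rcases eq_or_ne n 0 with rfl | hn
  · simp
  have hn' : (0 : ℝ) < n := by positivity
  have hs : √(n : ℝ) = (√(n : ℝ))⁻¹ * n := by
    rw [inv_mul_eq_div, Real.div_sqrt]
  rw [real_inner_smul_left]
  nth_rewrite 1 [hs]
  rw [mul_assoc]
  congr 1
  simp only [PiLp.inner_apply, boundaryOgive, boundaryCDF, PiLp.sub_apply, ogive_boundary hc,
    empiricalCDF, weightedIndicator, RCLike.inner_apply, conj_trivial]
  rw [Finset.sum_comm, Finset.mul_sum, Finset.mul_sum, ← Finset.sum_sub_distrib]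
  refine Finset.sum_congr rfl fun j _ => ?_
  rw [← Finset.mul_sum]
  field_simp

end boundary

theorem mainTheorem2 {Ω : Type*} [MeasurableSpace Ω] (P : Measure Ω) [IsProbabilityMeasure P]
    (θ : ℝ) (hθ : 0 < θ) (m : ℕ) (c : Fin (m + 1) → ℝ) (hc0 : c 0 = 0) (hc : StrictMono c)
    (X : ℕ → Ω → ℝ) (hlaw : ∀ i, HasLaw (X i) (expMeasure (1 / θ)) P) (hindep : iIndepFun X P) :
    IsAsymptoticallyNormal P (boundaryOgive c X) (boundaryCDF θ c) (boundaryCov θ c) := by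
  have : IsProbabilityMeasure (expMeasure (1 / θ)) :=
    isProbabilityMeasure_expMeasure (one_div_pos.2 hθ)
  have hS := posSemidef_boundaryCov hθ hc
  have hY (n : ℕ) :
      AEMeasurable (fun ω => √(n : ℝ) • (boundaryOgive c X n ω - boundaryCDF θ c)) P :=
    ((aemeasurable_boundaryOgive hc (fun i => (hlaw i).aemeasurable) n).sub_const
      (boundaryCDF θ c)).const_smul √(n : ℝ)
  refine ⟨hS, hY, aemeasurable_id, ProbabilityMeasure.tendsto_iff_tendsto_charFun.2 fun t => ?_⟩
  have hg := measurable_weightedIndicator (fun j => c (Fin.succ j)) t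
  have hvar : Var[fun ω => weightedIndicator (fun j => c (Fin.succ j)) t (X 0 ω); P] =
      dotProduct t ((boundaryCov θ c).mulVec t) := by
    rw [dotProduct_boundaryCov_mulVec hθ hc, ← (hlaw 0).map_eq,
      variance_map hg.aemeasurable (hlaw 0).aemeasurable]
    rfl
  have hmean : ∫ ω, weightedIndicator (fun j => c (Fin.succ j)) t (X 0 ω) ∂P =
      ∑ j, t j * expCDF θ (c j.succ) := by
    rw [← integral_map (hlaw 0).aemeasurable hg.aestronglyMeasurable, (hlaw 0).map_eq,
      integral_weightedIndicator]
    rfl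
  have hclt := tendstoInDistribution_inv_sqrt_mul_sum_sub (P := P)
    (X := fun i ω => weightedIndicator (fun j => c (Fin.succ j)) t (X i ω)) HasLaw.id
    ((memLp_map_measure_iff hg.aestronglyMeasurable (hlaw 0).aemeasurable).1
      (by rw [(hlaw 0).map_eq]; exact memLp_weightedIndicator _ _ _))
    (hindep.comp (fun _ => weightedIndicator _ t) fun _ => hg)
    fun i => ((hlaw i).identDistrib (hlaw 0)).comp hg
  have hlim := ProbabilityMeasure.tendsto_iff_tendsto_charFun.1 hclt.tendsto 1
  simp only [ProbabilityMeasure.coe_mk, Measure.map_id, charFun_gaussianReal, hmean, hvar] at hlim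
  simp only [ProbabilityMeasure.coe_mk, Measure.map_id, charFun_multivariateGaussian hS,
    charFun_map_eq_charFun_map_inner (hY _), inner_boundaryOgive_sub hc]
  convert hlim using 2
  -- The real Gaussian takes its variance in `ℝ≥0`; nonnegativity makes the truncation by
  -- `Real.toNNReal` harmless.
  have hnn : 0 ≤ dotProduct t ((boundaryCov θ c).mulVec t) := hvar ▸ variance_nonneg _ _
  simp [Real.coe_toNNReal _ hnn]
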